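/- Let $\operatorname{Homeo}^+(\mathbf{R})$ be the group of orientation-preserving homeomorphisms of the real line. For a group $G$, let $\operatorname{H}^2_b(G;\mathbf{R})$ be the second cohomology of the complex of bounded functions $G^n\to\mathbf{R}$ ($n\ge 0$) with the bar differential $$(\delta^n f)(g_1,\dots,g_{n+1})=f(g_2,\dots,g_{n+1})+\sum_{i=1}^n(-1)^i f(g_1,\dots,g_ig_{i+1},\dots,g_{n+1})+(-1)^{n+1}f(g_1,\dots,g_n).$$ A *chain of intervals* is a sequence $J_1,\dots,J_n$ of nonempty open intervals of $\mathbf{R}$, bounded or not, with increasing left endpoints, such that $J_i\cap J_{i+1}$ is a nonempty proper subset of both $J_i$ and $J_{i+1}$ for $1\le i<n$, and $J_i\cap J_k=\emptyset$ whenever $|i-k|>1$. A *chain group* is a group isomorphic to a subgroup $\langle f_1,\dots,f_n\rangle\le\operatorname{Homeo}^+(\mathbf{R})$ with $n\ge 2$, where the supports $J_i=\{x: f_i(x)\ne x\}$ form a chain of intervals, $f_i(t)\ge t$ for all $i$ and all $t\in\mathbf{R}$, and $\langle f_i,f_{i+1}\rangle$ is isomorphic to Thompson's group $F$ for $1\le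 i<n$. Here $F$ is the group of orientation-preserving piecewise linear homeomorphisms of $[0,1]$ with finitely many breakpoints, all dyadic rationals, and all slopes powers of $2$. The group of germs at $+\infty$ (at $-\infty$) of a subgroup $H\le\operatorname{Homeo}^+(\mathbf{R})$ is the quotient of $H$ by the subgroup of those elements that are the identity on a neighbourhood of $+\infty$ (of $-\infty$). **Corollary 1.5.** Let $G$ be a group such that 1. $G$ is a chain group, or 2. $G$ admits a faithful action on $\mathbf{R}$ by orientation-preserving homeomorphisms that is minimal (every orbit is dense) and whose groups of germs at $+\infty$ and at $-\infty$ are solvable. Then $\operatorname{H}^2_b(G;\mathbf{R})=0$. A coherent action on the real line is an action as in 2 that in addition contains a pair of elements of a prescribed dynamical type; so the result holds in particular for every group that admits a coherent action on the real line. -/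

import Mathlib

/-! ### Bounded cohomology of a discrete group with trivial real coefficients (bar resolution) -/

/-- The bar differential `δⁿ : Cⁿ(G) → Cⁿ⁺¹(G)` on real-valued functions on `Gⁿ`,
`(δⁿ f)(g₁, …, gₙ₊₁) = f(g₂, …, gₙ₊₁) + ∑_{i=1}^{n} (-1)ⁱ f(g₁, …, gᵢ gᵢ₊₁, …, gₙ₊₁)
  + (-1)ⁿ⁺¹ f(g₁, …, gₙ)`.
Here `Fin.contractNth j` multiplies the entries with (zero-based) indices `j` and `j + 1`. -/
def barDifferential (G : Type*) [Group G] (n : ℕ) :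
    ((Fin n → G) → ℝ) →ₗ[ℝ] ((Fin (n + 1) → G) → ℝ) where
  toFun f g :=
    f (fun i => g i.succ)
      + ∑ j : Fin n, (-1 : ℝ) ^ ((j : ℕ) + 1) * f (Fin.contractNth j.castSucc (· * ·) g)
      + (-1 : ℝ) ^ (n + 1) * f (fun i => g i.castSucc)
  map_add' f f' := by
    funext g
    simp only [Pi.add_apply, mul_add, Finset.sum_add_distrib]
    ring
  map_smul' c f := by
    funext g
    simp only [Pi.smul_apply, smul_eq_mul, RingHom.id_apply, mul_add, Finset.mul_sum,
      mul_left_comm]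

/-- `C_bⁿ(G)`: the bounded real-valued functions on `Gⁿ`. -/
def boundedCochains (G : Type*) [Group G] (n : ℕ) : Submodule ℝ ((Fin n → G) → ℝ) where
  carrier := {f | ∃ C : ℝ, ∀ g, |f g| ≤ C}
  zero_mem' := ⟨0, fun g => by simp⟩
  add_mem' := by
    rintro f f' ⟨C, hC⟩ ⟨C', hC'⟩
    exact ⟨C + C', fun g => (abs_add_le _ _).trans (add_le_add (hC g) (hC' g))⟩
  smul_mem' := by
    rintro c f ⟨C, hC⟩
    refine ⟨|c| * C, fun g => ?_⟩
    simp only [Pi.smul_apply, smul_eq_mul, abs_mul]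
    exact mul_le_mul_of_nonneg_left (hC g) (abs_nonneg c)

/-- `Z_bⁿ(G)`: the bounded cocycles. -/
def boundedCocycles (G : Type*) [Group G] (n : ℕ) : Submodule ℝ ((Fin n → G) → ℝ) :=
  boundedCochains G n ⊓ LinearMap.ker (barDifferential G n)

/-- `B_bⁿ(G)`: the coboundaries of *bounded* cochains. -/
def boundedCoboundaries (G : Type*) [Group G] : (n : ℕ) → Submodule ℝ ((Fin n → G) → ℝ)
  | 0 => ⊥
  | n + 1 => (boundedCochains G n).map (barDifferential G n)

/-- The bounded cohomology `H_bⁿ(G; ℝ) = Z_bⁿ(G) / B_bⁿ(G)`. -/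
abbrev BoundedCohomology (G : Type*) [Group G] (n : ℕ) : Type _ :=
  ↥(boundedCocycles G n) ⧸ (boundedCoboundaries G n).submoduleOf (boundedCocycles G n)

/-! ### Orientation-preserving homeomorphisms -/

/-- The group `Homeo⁺(M)` of orientation-preserving homeomorphisms of `M` (the real line or an
interval). -/
def HomeoPlus (M : Type*) [TopologicalSpace M] [LinearOrder M] : Subgroup (M ≃ₜ M) where
  carrier := {f | StrictMono f}
  one_mem' := fun _ _ h => h
  mul_mem' := fun {_ _} hf hg => hf.comp hg
  inv_mem' := by
    intro f hf x y h
    change f.symm x < f.symm y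
    rw [← hf.lt_iff_lt]
    simpa using h

/-! ### Thompson's group `F` -/

/-- Dyadic rational numbers. -/
def IsDyadic (x : ℝ) : Prop := ∃ (m : ℤ) (k : ℕ), x = m / 2 ^ k

theorem IsDyadic.add {x y : ℝ} (hx : IsDyadic x) (hy : IsDyadic y) : IsDyadic (x + y) := by
  obtain ⟨m, k, rfl⟩ := hx
  obtain ⟨m', k', rfl⟩ := hy
  refine ⟨m * 2 ^ k' + m' * 2 ^ k, k + k', ?_⟩
  push_cast
  rw [pow_add]
  field_simp

theorem IsDyadic.neg {x : ℝ} (hx : IsDyadic x) : IsDyadic (-x) := by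
  obtain ⟨m, k, rfl⟩ := hx
  exact ⟨-m, k, by push_cast; ring⟩

theorem IsDyadic.zpow_mul {x : ℝ} (hx : IsDyadic x) (n : ℤ) : IsDyadic ((2 : ℝ) ^ n * x) := by
  obtain ⟨m, k, rfl⟩ := hx
  obtain ⟨a, rfl | rfl⟩ := n.eq_nat_or_neg
  · refine ⟨2 ^ a * m, k, ?_⟩
    push_cast
    rw [zpow_natCast]
    ring
  · refine ⟨m, k + a, ?_⟩
    rw [zpow_neg, zpow_natCast, pow_add]
    field_simp

/-- `f : [0,1] → [0,1]` is affine, with slope a power of two, on every closed interval without a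
point of the finite set `S` in its interior. -/
def IsPiecewiseDyadic (f : unitInterval → unitInterval) (S : Finset unitInterval) : Prop :=
  ∀ x y : unitInterval, x < y → (∀ s ∈ S, ¬ (x < s ∧ s < y)) →
    ∃ n : ℤ, ∀ z : unitInterval, x ≤ z → z ≤ y →
      (f z : ℝ) = (f x : ℝ) + (2 : ℝ) ^ n * ((z : ℝ) - (x : ℝ))

theorem IsPiecewiseDyadic.isDyadic_iff {f : unitInterval → unitInterval}
    {S : Finset unitInterval} (hf : IsPiecewiseDyadic f S) (h0 : f 0 = 0)
    (hS : ∀ s ∈ S, IsDyadic (s : ℝ)) (x : unitInterval) :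
    IsDyadic (f x : ℝ) ↔ IsDyadic (x : ℝ) := by
  induction hk : (S.filter (· < x)).card using Nat.strong_induction_on generalizing x with
  | _ k ih =>
  have hd0 : IsDyadic 0 := ⟨0, 0, by simp⟩
  obtain rfl | hx : x = 0 ∨ 0 < x := by
    rcases eq_or_lt_of_le (show (0 : unitInterval) ≤ x from x.2.1) with h | h
    · exact Or.inl h.symm
    · exact Or.inr h
  · rw [h0]
  have key : ∀ s : unitInterval, s < x → (∀ t ∈ S, ¬ (s < t ∧ t < x)) → IsDyadic (s : ℝ) →
      IsDyadic (f s : ℝ) → (IsDyadic (f x : ℝ) ↔ IsDyadic (x : ℝ)) := by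
    intro s hs hst hds hdf
    obtain ⟨n, hn⟩ := hf s x hs hst
    have h := hn x hs.le le_rfl
    constructor
    · intro h1
      have h2 := ((h1.add hdf.neg).zpow_mul (-n)).add hds
      have h3 : (x : ℝ) = (2 : ℝ) ^ (-n) * ((f x : ℝ) + -(f s : ℝ)) + (s : ℝ) := by
        rw [h, zpow_neg]
        field_simp
        ring
      rw [h3]
      exact h2
    · intro h1
      rw [h]
      exact hdf.add ((h1.add hds.neg).zpow_mul n)
  by_cases hne : (S.filter (· < x)).Nonempty
  · obtain ⟨hm1, hm2⟩ := Finset.mem_filter.1 ((S.filter (· < x)).max'_mem hne)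
    set s := (S.filter (· < x)).max' hne with hs
    refine key s hm2 (fun t ht hst => ?_) (hS s hm1) ?_
    · exact absurd ((S.filter (· < x)).le_max' t (Finset.mem_filter.2 ⟨ht, hst.2⟩))
        (not_le.2 hst.1)
    · refine (ih _ ?_ s rfl).2 (hS s hm1)
      rw [← hk]
      refine Finset.card_lt_card ((Finset.ssubset_iff_of_subset ?_).2 ⟨s, ?_, ?_⟩)
      · intro t ht
        rw [Finset.mem_filter] at ht ⊢
        exact ⟨ht.1, ht.2.trans hm2⟩
      · exact Finset.mem_filter.2 ⟨hm1, hm2⟩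
      · simp
  · refine key 0 hx (fun t ht hst => hne ⟨t, Finset.mem_filter.2 ⟨ht, hst.2⟩⟩) ?_ ?_
    · simpa using hd0
    · simpa [h0] using hd0

theorem HomeoPlus.map_zero (f : HomeoPlus unitInterval) : f.1 0 = 0 := by
  have h : f.1 0 ≤ f.1 (f.1.symm 0) := f.2.monotone (f.1.symm 0).2.1
  rw [f.1.apply_symm_apply] at h
  exact le_antisymm h (f.1 0).2.1

/-- Thompson's group `F`: the orientation-preserving piecewise linear homeomorphisms of `[0,1]`
with finitely many breakpoints, all of them dyadic rationals, and all slopes powers of two. -/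
def ThompsonF : Subgroup (HomeoPlus unitInterval) where
  carrier := {f | ∃ S : Finset unitInterval,
    (∀ s ∈ S, IsDyadic (s : ℝ)) ∧ IsPiecewiseDyadic f.1 S}
  one_mem' := ⟨∅, by simp, fun x y _ _ => ⟨0, fun z _ _ => by simp⟩⟩
  mul_mem' := by
    classical
    rintro g f ⟨T, hT, hg⟩ ⟨S, hS, hf⟩
    refine ⟨S ∪ T.image f.1.symm, ?_, ?_⟩
    · intro s hs
      rcases Finset.mem_union.1 hs with hs | hs
      · exact hS s hs
      · obtain ⟨t, ht, rfl⟩ := Finset.mem_image.1 hs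
        rw [← hf.isDyadic_iff (HomeoPlus.map_zero f) hS]
        simpa using hT t ht
    · intro x y hxy hno
      obtain ⟨n, hn⟩ := hf x y hxy (fun s hs => hno s (Finset.mem_union_left _ hs))
      obtain ⟨m, hm⟩ := hg (f.1 x) (f.1 y) (f.2 hxy) (by
        rintro t ht ⟨h1, h2⟩
        refine hno (f.1.symm t)
          (Finset.mem_union_right _ (Finset.mem_image_of_mem _ ht)) ⟨?_, ?_⟩
        · rw [← StrictMono.lt_iff_lt f.2]; simpa using h1
        · rw [← StrictMono.lt_iff_lt f.2]; simpa using h2)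
      refine ⟨m + n, fun z h1 h2 => ?_⟩
      have h3 := hm (f.1 z) (f.2.monotone h1) (f.2.monotone h2)
      rw [hn z h1 h2] at h3
      change (g.1 (f.1 z) : ℝ) = (g.1 (f.1 x) : ℝ) + _
      rw [h3, zpow_add₀ two_ne_zero]
      ring
  inv_mem' := by
    classical
    rintro f ⟨S, hS, hf⟩
    refine ⟨S.image f.1, ?_, ?_⟩
    · intro s hs
      obtain ⟨t, ht, rfl⟩ := Finset.mem_image.1 hs
      exact (hf.isDyadic_iff (HomeoPlus.map_zero f) hS t).2 (hS t ht)
    · intro x y hxy hno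
      have hinv : StrictMono (f⁻¹).1 := (f⁻¹).2
      have hr : ∀ z, f.1 ((f⁻¹).1 z) = z := fun z => f.1.apply_symm_apply z
      obtain ⟨n, hn⟩ := hf ((f⁻¹).1 x) ((f⁻¹).1 y) (hinv hxy) (by
        rintro t ht ⟨h1, h2⟩
        refine hno (f.1 t) (Finset.mem_image_of_mem _ ht) ⟨?_, ?_⟩
        · have := f.2 h1
          rwa [hr] at this
        · have := f.2 h2
          rwa [hr] at this)
      refine ⟨-n, fun z h1 h2 => ?_⟩
      have h3 := hn ((f⁻¹).1 z) (hinv.monotone h1) (hinv.monotone h2)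
      rw [hr, hr] at h3
      rw [h3, zpow_neg]
      field_simp
      ring

/-! ### Chain groups -/

/-- The open interval `(a, b)` of the real line, with endpoints in `[-∞, ∞]`. -/
def openInterval (a b : EReal) : Set ℝ := {x : ℝ | a < (x : EReal) ∧ (x : EReal) < b}

/-- A chain of intervals `J₁, …, Jₙ`, `Jᵢ = (aᵢ, bᵢ)`, listed from left to right: each is a
nonempty open interval, consecutive ones meet in a proper nonempty subinterval of both, and
non-consecutive ones are disjoint. -/
structure IsChainOfIntervals {n : ℕ} (a b : Fin n → EReal) : Prop where
  nonempty : ∀ i, (openInterval (a i) (b i)).Nonempty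
  left_lt : ∀ i j : Fin n, (j : ℕ) = i + 1 → a i < a j
  inter_nonempty : ∀ i j : Fin n, (j : ℕ) = i + 1 →
    (openInterval (a i) (b i) ∩ openInterval (a j) (b j)).Nonempty
  inter_ssubset_left : ∀ i j : Fin n, (j : ℕ) = i + 1 →
    openInterval (a i) (b i) ∩ openInterval (a j) (b j) ⊂ openInterval (a i) (b i)
  inter_ssubset_right : ∀ i j : Fin n, (j : ℕ) = i + 1 →
    openInterval (a i) (b i) ∩ openInterval (a j) (b j) ⊂ openInterval (a j) (b j)
  disjoint : ∀ i j : Fin n, (i : ℕ) + 1 < j →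
    Disjoint (openInterval (a i) (b i)) (openInterval (a j) (b j))

/-- `G` is (isomorphic to) a chain group: the group generated by `n ≥ 2` homeomorphisms
`f₁, …, fₙ` of the real line such that the supports `{x | fᵢ x ≠ x}` form a chain of intervals,
`fᵢ t ≥ t` for all `t`, and `⟨fᵢ, fᵢ₊₁⟩` is isomorphic to Thompson's group `F` for every
`i < n`. -/
def IsChainGroup (G : Type*) [Group G] : Prop :=
  ∃ (n : ℕ) (a b : Fin n → EReal) (f : Fin n → HomeoPlus ℝ),
    2 ≤ n ∧
    IsChainOfIntervals a b ∧
    (∀ i, {x : ℝ | (f i).1 x ≠ x} = openInterval (a i) (b i)) ∧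
    (∀ i t, t ≤ (f i).1 t) ∧
    (∀ i j : Fin n, (j : ℕ) = i + 1 →
      Nonempty (Subgroup.closure {f i, f j} ≃* ThompsonF)) ∧
    Nonempty (G ≃* Subgroup.closure (Set.range f))

/-! ### Minimal actions on the line with solvable germs -/

theorem HomeoPlus.tendsto_atTop (f : HomeoPlus ℝ) :
    Filter.Tendsto f.1 Filter.atTop Filter.atTop :=
  Filter.tendsto_atTop_atTop_of_monotone f.2.monotone
    (fun y => ⟨f.1.symm y, (f.1.apply_symm_apply y).ge⟩)

theorem HomeoPlus.tendsto_atBot (f : HomeoPlus ℝ) :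
    Filter.Tendsto f.1 Filter.atBot Filter.atBot :=
  Filter.tendsto_atBot_atBot_of_monotone f.2.monotone
    (fun y => ⟨f.1.symm y, (f.1.apply_symm_apply y).le⟩)

/-- The homeomorphisms with trivial germ at `+∞`, i.e. equal to the identity near `+∞`. -/
def trivialGermTop : Subgroup (HomeoPlus ℝ) where
  carrier := {f | ∀ᶠ x in Filter.atTop, f.1 x = x}
  one_mem' := Filter.Eventually.of_forall fun _ => rfl
  mul_mem' := by
    intro f g hf hg
    filter_upwards [hf, hg] with x h1 h2
    change f.1 (g.1 x) = x
    rw [h2, h1]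
  inv_mem' := by
    intro f hf
    filter_upwards [hf] with x h
    change f.1.symm x = x
    rw [f.1.symm_apply_eq, h]

/-- The homeomorphisms with trivial germ at `-∞`, i.e. equal to the identity near `-∞`. -/
def trivialGermBot : Subgroup (HomeoPlus ℝ) where
  carrier := {f | ∀ᶠ x in Filter.atBot, f.1 x = x}
  one_mem' := Filter.Eventually.of_forall fun _ => rfl
  mul_mem' := by
    intro f g hf hg
    filter_upwards [hf, hg] with x h1 h2
    change f.1 (g.1 x) = x
    rw [h2, h1]
  inv_mem' := by
    intro f hf
    filter_upwards [hf] with x h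
    change f.1.symm x = x
    rw [f.1.symm_apply_eq, h]

instance trivialGermTop_normal : trivialGermTop.Normal where
  conj_mem := by
    intro f hf g
    filter_upwards [(HomeoPlus.tendsto_atTop g⁻¹).eventually hf] with x h
    change g.1 (f.1 ((g⁻¹).1 x)) = x
    rw [h]
    exact g.1.apply_symm_apply x

instance trivialGermBot_normal : trivialGermBot.Normal where
  conj_mem := by
    intro f hf g
    filter_upwards [(HomeoPlus.tendsto_atBot g⁻¹).eventually hf] with x h
    change g.1 (f.1 ((g⁻¹).1 x)) = x
    rw [h]
    exact g.1.apply_symm_apply x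

/-- The group of germs at `+∞` of a group of homeomorphisms of the line: its image in the group
`Homeo⁺(ℝ) / {f | f is the identity near +∞}` of all germs at `+∞`. -/
noncomputable def germsTop (H : Subgroup (HomeoPlus ℝ)) : Subgroup (HomeoPlus ℝ ⧸ trivialGermTop) :=
  H.map (QuotientGroup.mk' trivialGermTop)

/-- The group of germs at `-∞` of a group of homeomorphisms of the line. -/
noncomputable def germsBot (H : Subgroup (HomeoPlus ℝ)) : Subgroup (HomeoPlus ℝ ⧸ trivialGermBot) :=
  H.map (QuotientGroup.mk' trivialGermBot)

/-- `G` admits a faithful action on the real line by orientation-preserving homeomorphisms which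
is minimal (every orbit is dense) and whose groups of germs at `+∞` and at `-∞` are solvable.

A coherent action is, by definition, an action of this kind that contains in addition a pair of
elements of a prescribed dynamical type.  That pair is not asked for here, so every group with a
coherent action satisfies this predicate. -/
def AdmitsMinimalActionWithSolvableGerms (G : Type*) [Group G] : Prop :=
  ∃ φ : G →* HomeoPlus ℝ,
    Function.Injective φ ∧
    (∀ x : ℝ, Dense (Set.range fun g : G => (φ g).1 x)) ∧
    Group.IsSolvable (germsTop φ.range) ∧
    Group.IsSolvable (germsBot φ.range)

/-! A bounded 2-cocycle `c` defines a central extension `E` of `G` by `ℝ` on which the fibre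
coordinate is a quasimorphism whose defect function is `c`. Let `ψ` be its homogenization. It
restricts to the identity on the central `ℝ`, so as soon as `ψ` is a homomorphism, `g ↦ ψ (g, 0)` is
a bounded primitive of `c`.

Homogeneous quasimorphisms are conjugation invariant and additive on commuting elements. A central
commutator in `E` is therefore trivial, and commutation lifts from `G` to `E`
(`commute_of_commute_base`). If any two elements of some derived subgroup of `G` commute with their
conjugates by a common `t`, a doubling argument (`map_mul_of_commuting_conjugates`) makes `ψ`
additive on the corresponding derived subgroup of `E`; additivity then climbs from `⁅L, L⁆` to `L`
(`map_mul_of_commutator`) until it reaches `E`.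

The dynamics provide `t`: each element of a suitable derived subgroup is supported in a compact
interval of a set `J`, and some group element pushes that interval past itself. For minimal actions
`J = ℝ`, and solvability of the germs kills a derived subgroup near both ends. For chain groups `J`
is the union of the supports; near each end of `J` a single generator acts, so the germs are cyclic
and commutators die there. -/

open scoped commutatorElement

/-! ### Homogeneous quasimorphisms -/

/-- `ψ` is a homogeneous quasimorphism with defect at most `D`. -/
structure IsHomogeneousQuasimorphism {E : Type*} [Group E] (ψ : E → ℝ) (D : ℝ) : Prop where
  defect_le : ∀ x y, |ψ (x * y) - ψ x - ψ y| ≤ D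
  map_pow : ∀ x (n : ℕ), ψ (x ^ n) = n * ψ x

/-- Turns bounded errors into exact identities: an error that is multiplied by `n` on passing to
`n`-th powers, yet stays bounded, must vanish. -/
theorem eq_zero_of_forall_nat_mul_abs_le {a C : ℝ} (h : ∀ n : ℕ, n * |a| ≤ C) : a = 0 := by
  by_contra ha
  obtain ⟨n, hn⟩ := exists_nat_gt (C / |a|)
  rw [div_lt_iff₀ (abs_pos.2 ha)] at hn
  exact absurd (h n) (not_le.2 hn)

/-- Every quasimorphism is at bounded distance from a homogeneous one. -/
theorem exists_homogeneousQuasimorphism {E : Type*} [Group E] {φ : E → ℝ} {C : ℝ}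
    (hφ : ∀ x y, |φ (x * y) - φ x - φ y| ≤ C) :
    ∃ ψ, IsHomogeneousQuasimorphism ψ (4 * C) ∧ ∀ x, |ψ x - φ x| ≤ C := by
  -- Splitting `x ^ (n + 1)` into its factors takes `n` products, each costing `C`.
  have hpow : ∀ x (n : ℕ), |φ (x ^ (n + 1)) - (n + 1) * φ x| ≤ n * C := by
    intro x n
    induction n with
    | zero => simp
    | succ n ih =>
      have h := hφ (x ^ (n + 1)) x
      rw [← pow_succ] at h
      rw [abs_le] at *
      push_cast
      constructor <;> linarith [h.1, h.2, ih.1, ih.2]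
  have hpos : 0 ≤ C := (abs_nonneg _).trans (hφ 1 1)
  have hlim : ∀ x, ∃ l, Filter.Tendsto (fun n : ℕ => φ (x ^ n) / n) Filter.atTop (nhds l) := by
    intro x
    -- Adding `C` makes the sequence subadditive, so Fekete's lemma applies; the correction `C / n`
    -- tends to `0`.
    have hsub : Subadditive fun n : ℕ => φ (x ^ n) + C := by
      intro m n
      have h := (abs_le.1 (hφ (x ^ m) (x ^ n))).2
      rw [← pow_add] at h
      linarith
    have hbdd : BddBelow (Set.range fun n : ℕ => (φ (x ^ n) + C) / n) := by
      -- The `0` covers the index `n = 0`, where division by zero gives `0`.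
      refine ⟨min 0 (φ x - C), ?_⟩
      rintro _ ⟨n, rfl⟩
      rcases n with _ | n
      · simp
      · refine (min_le_right _ _).trans ?_
        have h := (abs_le.1 (hpow x n)).1
        rw [le_div_iff₀ (by positivity)]
        push_cast
        linarith
    refine ⟨hsub.lim, ?_⟩
    have h := (hsub.tendsto_lim hbdd).sub (tendsto_const_div_atTop_nhds_zero_nat C)
    simpa [add_div] using h
  choose ψ hψ using hlim
  have hnear : ∀ x, |ψ x - φ x| ≤ C := by
    intro x
    have h := ((hψ x).sub_const (φ x)).abs
    refine le_of_tendsto h (Filter.eventually_atTop.2 ⟨1, fun n hn => ?_⟩)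
    obtain ⟨n, rfl⟩ := Nat.exists_eq_add_of_le' hn
    have h1 := hpow x n
    have h2 : φ (x ^ (n + 1)) / ((n + 1 : ℕ) : ℝ) - φ x
        = (φ (x ^ (n + 1)) - (n + 1) * φ x) / (n + 1) := by
      push_cast
      field_simp
    rw [h2, abs_div, abs_of_pos (by positivity : (0 : ℝ) < n + 1), div_le_iff₀ (by positivity)]
    linarith
  refine ⟨ψ, ⟨fun x y => ?_, fun x n => ?_⟩, hnear⟩
  -- The constant `4 * C` is the defect `C` of `φ` plus three replacements of `φ` by `ψ`.
  · have h1 := abs_le.1 (hnear x)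
    have h2 := abs_le.1 (hnear y)
    have h3 := abs_le.1 (hnear (x * y))
    have h4 := abs_le.1 (hφ x y)
    rw [abs_le]
    constructor <;> linarith [h1.1, h1.2, h2.1, h2.2, h3.1, h3.2, h4.1, h4.2]
  · rcases n.eq_zero_or_pos with rfl | hn
    · have h1 : Filter.Tendsto (fun n : ℕ => φ ((1 : E) ^ n) / n) Filter.atTop (nhds 0) := by
        simpa using tendsto_const_div_atTop_nhds_zero_nat (φ 1)
      simpa using tendsto_nhds_unique (hψ 1) h1
    · have h1 := (hψ x).comp (Filter.tendsto_id.const_mul_atTop' hn)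
      refine tendsto_nhds_unique (hψ (x ^ n)) ((h1.const_mul (n : ℝ)).congr fun m => ?_)
      have hn' : (n : ℝ) ≠ 0 := by positivity
      simp only [Function.comp_apply, id, pow_mul]
      push_cast
      field_simp

namespace IsHomogeneousQuasimorphism

variable {E : Type*} [Group E] {ψ : E → ℝ} {D : ℝ}

/-- Here `(x * y) ^ n = x ^ n * y ^ n`, so `n` times the error is the error at the `n`-th powers,
still at most `D`. -/
theorem map_mul_of_commute (hψ : IsHomogeneousQuasimorphism ψ D) {x y : E} (h : Commute x y) :
    ψ (x * y) = ψ x + ψ y := by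
  suffices ψ (x * y) - ψ x - ψ y = 0 by linarith
  refine eq_zero_of_forall_nat_mul_abs_le (C := D) fun n => ?_
  have h1 := hψ.defect_le (x ^ n) (y ^ n)
  rw [← h.mul_pow, hψ.map_pow, hψ.map_pow, hψ.map_pow, ← mul_sub, ← mul_sub, abs_mul,
    Nat.abs_cast] at h1
  exact h1

theorem map_one (hψ : IsHomogeneousQuasimorphism ψ D) : ψ 1 = 0 := by
  simpa using hψ.map_pow 1 0

theorem map_inv (hψ : IsHomogeneousQuasimorphism ψ D) (x : E) : ψ x⁻¹ = -ψ x := by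
  have h := hψ.map_mul_of_commute ((Commute.refl x).inv_right)
  rw [mul_inv_cancel, hψ.map_one] at h
  linarith

/-- Conjugation commutes with powers and the contributions of `y` and `y⁻¹` cancel, so `n` times the
difference stays within two defects. -/
theorem map_conj (hψ : IsHomogeneousQuasimorphism ψ D) (y x : E) :
    ψ (y * x * y⁻¹) = ψ x := by
  suffices ψ (y * x * y⁻¹) - ψ x = 0 by linarith
  refine eq_zero_of_forall_nat_mul_abs_le (C := 2 * D) fun n => ?_
  have h1 := abs_le.1 (hψ.defect_le (y * x ^ n) y⁻¹)
  have h2 := abs_le.1 (hψ.defect_le y (x ^ n))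
  rw [← conj_pow, hψ.map_pow, hψ.map_inv] at h1
  rw [hψ.map_pow] at h2
  rw [← Nat.abs_cast, ← abs_mul, mul_sub, abs_le]
  constructor <;> linarith [h1.1, h1.2, h2.1, h2.2]

/-- A homogeneous quasimorphism is additive on a subgroup in which any two elements commute with
their conjugates by a suitable element. -/
theorem map_mul_of_commuting_conjugates (hψ : IsHomogeneousQuasimorphism ψ D) (L : Subgroup E)
    [hn : L.Normal] (hL : ∀ x ∈ L, ∀ y ∈ L, ∃ t : E, ∀ u ∈ ({x, y} : Set E),
      ∀ v ∈ ({x, y} : Set E), Commute u (t * v * t⁻¹)) {x y : E} (hx : x ∈ L) (hy : y ∈ L) :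
    ψ (x * y) = ψ x + ψ y := by
  -- Replace `x`, `y` by `x * xᵗ`, `y * yᵗ`, whose product is `(x * y) * (x * y)ᵗ`. All three values
  -- of `ψ` double, hence so does the error; iterating inside the normal subgroup `L` makes it grow
  -- like `2 ^ k` under the fixed bound `D`.
  have halve : ∀ (k : ℕ), ∀ x ∈ L, ∀ y ∈ L, 2 ^ k * |ψ (x * y) - ψ x - ψ y| ≤ D := by
    intro k
    induction k with
    | zero => intro x _ y _; simpa using hψ.defect_le x y
    | succ k ih =>
      intro x hx y hy
      obtain ⟨t, ht⟩ := hL x hx y hy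
      have hxx := ht x (by simp) x (by simp)
      have hxy := ht x (by simp) y (by simp)
      have hyx := ht y (by simp) x (by simp)
      have hyy := ht y (by simp) y (by simp)
      have h1 := ih (x * (t * x * t⁻¹)) (L.mul_mem hx (hn.conj_mem x hx t))
        (y * (t * y * t⁻¹)) (L.mul_mem hy (hn.conj_mem y hy t))
      have h2 : x * (t * x * t⁻¹) * (y * (t * y * t⁻¹)) = x * y * (t * (x * y) * t⁻¹) := by
        rw [mul_assoc, ← mul_assoc (t * x * t⁻¹), ← hyx.eq]
        group
      have h3 : Commute (x * y) (t * (x * y) * t⁻¹) := by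
        rw [← conj_mul]
        exact (hxx.mul_left hyx).mul_right (hxy.mul_left hyy)
      rw [h2, hψ.map_mul_of_commute h3, hψ.map_mul_of_commute hxx, hψ.map_mul_of_commute hyy,
        hψ.map_conj, hψ.map_conj, hψ.map_conj] at h1
      have h4 : ψ (x * y) + ψ (x * y) - (ψ x + ψ x) - (ψ y + ψ y)
          = 2 * (ψ (x * y) - ψ x - ψ y) := by ring
      rw [h4, abs_mul, abs_two, ← mul_assoc, ← pow_succ] at h1
      exact h1
  suffices ψ (x * y) - ψ x - ψ y = 0 by linarith
  refine eq_zero_of_forall_nat_mul_abs_le (C := D) fun n => ?_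
  refine le_trans (mul_le_mul_of_nonneg_right ?_ (abs_nonneg _)) (halve n x hx y hy)
  exact_mod_cast n.lt_two_pow_self.le

/-- A homogeneous quasimorphism which is additive on the commutator subgroup `⁅L, L⁆` is additive
on `L`. -/
theorem map_mul_of_commutator (hψ : IsHomogeneousQuasimorphism ψ D) (L : Subgroup E)
    (hL : ∀ x ∈ ⁅L, L⁆, ∀ y ∈ ⁅L, L⁆, ψ (x * y) = ψ x + ψ y) {x y : E} (hx : x ∈ L)
    (hy : y ∈ L) : ψ (x * y) = ψ x + ψ y := by
  -- The value on `⁅g ^ n, h⁆` grows linearly in `n`, but it is also bounded by `D`, since this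
  -- element is the product of `g ^ n` and a conjugate of its inverse.
  have hcomm : ∀ g ∈ L, ∀ h ∈ L, ψ ⁅g, h⁆ = 0 := by
    intro g hg h hh
    have hpow : ∀ n : ℕ, ψ ⁅g ^ n, h⁆ = n * ψ ⁅g, h⁆ := by
      intro n
      induction n with
      | zero => simp [hψ.map_one]
      | succ n ih =>
        have h1 : ⁅g ^ (n + 1), h⁆ = (g * ⁅g ^ n, h⁆ * g⁻¹) * ⁅g, h⁆ := by
          simp only [commutatorElement_def, pow_succ']
          group
        have h2 : g * ⁅g ^ n, h⁆ * g⁻¹ ∈ ⁅L, L⁆ := by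
          have h3 : g * ⁅g ^ n, h⁆ * g⁻¹ = ⁅g ^ n, g * h * g⁻¹⁆ := by
            rw [← MulAut.conj_apply, map_commutatorElement, MulAut.conj_apply, MulAut.conj_apply,
              ← pow_succ', pow_succ, mul_inv_cancel_right]
          rw [h3]
          exact Subgroup.commutator_mem_commutator (L.pow_mem hg n)
            (L.mul_mem (L.mul_mem hg hh) (L.inv_mem hg))
        rw [h1, hL _ h2 _ (Subgroup.commutator_mem_commutator hg hh), hψ.map_conj, ih]
        push_cast
        ring
    refine eq_zero_of_forall_nat_mul_abs_le (C := D) fun n => ?_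
    rw [← Nat.abs_cast, ← abs_mul, ← hpow n]
    have h1 := hψ.defect_le (g ^ n) (h * (g ^ n)⁻¹ * h⁻¹)
    rw [hψ.map_conj, hψ.map_inv] at h1
    simpa [commutatorElement_def, mul_assoc] using h1
  have hzero : ∀ c ∈ ⁅L, L⁆, ψ c = 0 := by
    intro c hc
    rw [Subgroup.commutator_def] at hc
    induction hc using Subgroup.closure_induction with
    | mem c hc =>
      obtain ⟨g, hg, h, hh, rfl⟩ := hc
      exact hcomm g hg h hh
    | one => exact hψ.map_one
    | mul a b ha hb iha ihb =>
      rw [← Subgroup.commutator_def] at ha hb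
      rw [hL a ha b hb, iha, ihb, add_zero]
    | inv a ha iha => rw [hψ.map_inv, iha, neg_zero]
  have hmul : ∀ n : ℕ, ∃ c ∈ ⁅L, L⁆, (x * y) ^ n = x ^ n * y ^ n * c := by
    intro n
    induction n with
    | zero => exact ⟨1, one_mem _, by simp⟩
    | succ n ih =>
      obtain ⟨c, hc, h⟩ := ih
      -- The commutator solves `x * y * x ^ n * y ^ n = x ^ (n + 1) * y ^ (n + 1) * ⁅·, y⁆`.
      refine ⟨⁅(y ^ (n + 1))⁻¹ * (x ^ n)⁻¹ * y ^ (n + 1), y⁆ * c, mul_mem ?_ hc, ?_⟩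
      · exact Subgroup.commutator_mem_commutator (L.mul_mem (L.mul_mem
          (L.inv_mem (L.pow_mem hy _)) (L.inv_mem (L.pow_mem hx _))) (L.pow_mem hy _)) hy
      · rw [pow_succ', h, commutatorElement_def]
        group
  suffices ψ (x * y) - ψ x - ψ y = 0 by linarith
  refine eq_zero_of_forall_nat_mul_abs_le (C := 2 * D) fun n => ?_
  obtain ⟨c, hc, h⟩ := hmul n
  have h1 := abs_le.1 (hψ.defect_le (x ^ n * y ^ n) c)
  have h2 := abs_le.1 (hψ.defect_le (x ^ n) (y ^ n))
  rw [← h, hψ.map_pow, hzero c hc] at h1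
  rw [hψ.map_pow x, hψ.map_pow y] at h2
  rw [← Nat.abs_cast, ← abs_mul, mul_sub, mul_sub, abs_le]
  constructor <;> linarith [h1.1, h1.2, h2.1, h2.2]

end IsHomogeneousQuasimorphism

/-! ### The central extension defined by a `2`-cocycle -/

/-- An inhomogeneous real `2`-cocycle on `G`. -/
structure RealCocycle (G : Type*) [Group G] where
  toFun : G → G → ℝ
  cocycle : ∀ g h k, toFun h k + toFun g (h * k) = toFun (g * h) k + toFun g h

namespace RealCocycle

variable {G : Type*} [Group G] (c : RealCocycle G)

theorem one_left (g : G) : c.toFun 1 g = c.toFun 1 1 := by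
  have h := c.cocycle 1 1 g
  simp only [one_mul] at h
  linarith

theorem one_right (g : G) : c.toFun g 1 = c.toFun 1 1 := by
  have h := c.cocycle g 1 1
  simp only [mul_one] at h
  linarith

/-- The central extension of `G` by `ℝ` with cocycle `c`. -/
@[ext]
structure Extension (c : RealCocycle G) where
  base : G
  fiber : ℝ

namespace Extension

variable {c}

instance : Mul c.Extension :=
  ⟨fun x y => ⟨x.base * y.base, x.fiber + y.fiber + c.toFun x.base y.base⟩⟩

/-- The cocycle is not normalized, so the identity carries the shift `-c.toFun 1 1`; the same shift
recurs in inverses and in `central`. -/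
instance : One c.Extension := ⟨⟨1, -c.toFun 1 1⟩⟩

instance : Inv c.Extension :=
  ⟨fun x => ⟨x.base⁻¹, -x.fiber - c.toFun x.base⁻¹ x.base - c.toFun 1 1⟩⟩

@[simp] theorem base_mul (x y : c.Extension) : (x * y).base = x.base * y.base := rfl

@[simp] theorem fiber_mul (x y : c.Extension) :
    (x * y).fiber = x.fiber + y.fiber + c.toFun x.base y.base := rfl

@[simp] theorem base_one : (1 : c.Extension).base = 1 := rfl

@[simp] theorem fiber_one : (1 : c.Extension).fiber = -c.toFun 1 1 := rfl

@[simp] theorem base_inv (x : c.Extension) : x⁻¹.base = x.base⁻¹ := rfl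

@[simp] theorem fiber_inv (x : c.Extension) :
    x⁻¹.fiber = -x.fiber - c.toFun x.base⁻¹ x.base - c.toFun 1 1 := rfl

instance : Group c.Extension :=
  Group.ofLeftAxioms
    (fun x y z => by
      ext
      · simp [mul_assoc]
      · have h := c.cocycle x.base y.base z.base
        simp only [fiber_mul, base_mul]
        linarith)
    (fun x => by
      ext
      · simp
      · simp [c.one_left])
    (fun x => by
      ext
      · simp
      · simp only [fiber_mul, fiber_inv, base_inv, fiber_one]; ring)

/-- The projection of the extension onto `G`. -/
def proj : c.Extension →* G where
  toFun := base
  map_one' := rfl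
  map_mul' _ _ := rfl

/-- The central element lying over the real number `s`. -/
def central (s : ℝ) : c.Extension := ⟨1, s - c.toFun 1 1⟩

theorem mul_central (x : c.Extension) (s : ℝ) : x * central s = ⟨x.base, x.fiber + s⟩ := by
  ext
  · simp [central]
  · simp [central, c.one_right]; ring

theorem central_mul (x : c.Extension) (s : ℝ) : central s * x = ⟨x.base, x.fiber + s⟩ := by
  ext
  · simp [central]
  · simp [central, c.one_left]; ring

theorem commute_central (x : c.Extension) (s : ℝ) : Commute x (central s) :=
  (mul_central x s).trans (central_mul x s).symm

theorem central_pow (s : ℝ) (n : ℕ) : (central s : c.Extension) ^ n = central (n * s) := by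
  induction n with
  | zero => ext <;> simp [central]
  | succ n ih =>
    rw [pow_succ, ih, mul_central]
    ext
    · simp [central]
    · simp [central]; ring

theorem eq_mul_central {x y : c.Extension} (h : x.base = y.base) :
    x = y * central (x.fiber - y.fiber) := by
  rw [mul_central]
  ext <;> simp [h]

end Extension

open Extension

/-- The powers of `central s` are `central (n * s)`, on which `ψ` is within a constant of `n * s`;
homogeneity removes the constant. -/
theorem map_central {ψ : c.Extension → ℝ} {D C : ℝ} (hψ : IsHomogeneousQuasimorphism ψ D)
    (hC : ∀ x, |ψ x - x.fiber| ≤ C) (s : ℝ) : ψ (central s) = s := by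
  suffices ψ (central s) - s = 0 by linarith
  refine eq_zero_of_forall_nat_mul_abs_le (C := C + |c.toFun 1 1|) fun n => ?_
  have h := abs_le.1 (hC (central s ^ n))
  rw [hψ.map_pow, central_pow] at h
  simp only [central] at h
  have h2 := abs_le.1 (le_refl |c.toFun 1 1|)
  rw [← Nat.abs_cast, ← abs_mul, mul_sub, abs_le]
  constructor <;> simp only [central] <;> linarith [h.1, h.2, h2.1, h2.2]

theorem map_mul_central {ψ : c.Extension → ℝ} {D C : ℝ} (hψ : IsHomogeneousQuasimorphism ψ D)
    (hC : ∀ x, |ψ x - x.fiber| ≤ C) (x : c.Extension) (s : ℝ) :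
    ψ (x * central s) = ψ x + s := by
  rw [hψ.map_mul_of_commute (commute_central x s), c.map_central hψ hC]

/-- In the central extension defined by a bounded cocycle, two elements commute as soon as their
projections commute. -/
theorem commute_of_commute_base {ψ : c.Extension → ℝ} {D C : ℝ}
    (hψ : IsHomogeneousQuasimorphism ψ D) (hC : ∀ x, |ψ x - x.fiber| ≤ C) {x y : c.Extension}
    (h : Commute x.base y.base) : Commute x y := by
  -- The conjugate and `x` lie over the same element, so they differ by a central `s`; conjugation
  -- invariance reads `ψ x + s = ψ x`, whence `s = 0`.
  have h1 : (y * x * y⁻¹).base = x.base := by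
    simp only [base_mul, base_inv, ← h.eq, mul_inv_cancel_right]
  have h2 := eq_mul_central h1
  have h3 : ψ (y * x * y⁻¹) = ψ x := hψ.map_conj y x
  rw [h2, c.map_mul_central hψ hC] at h3
  have h4 : (central 0 : c.Extension) = 1 := by ext <;> simp [central]
  have h5 : (y * x * y⁻¹).fiber - x.fiber = 0 := by linarith
  rw [h5, h4, mul_one, mul_inv_eq_iff_eq_mul] at h2
  exact h2.symm

end RealCocycle

/-! ### Vanishing of the second bounded cohomology from commuting conjugates -/

/-- If any two elements of some term `L` of the derived series of `G` commute with their conjugates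
by a suitable element of `G`, then every bounded `2`-cocycle is the coboundary of a bounded
function. -/
theorem RealCocycle.exists_bounded_primitive {G : Type*} [Group G] (n : ℕ)
    (hL : ∀ x ∈ derivedSeries G n, ∀ y ∈ derivedSeries G n, ∃ t : G,
      ∀ u ∈ ({x, y} : Set G), ∀ v ∈ ({x, y} : Set G), Commute u (t * v * t⁻¹))
    (c : RealCocycle G) {C : ℝ} (hc : ∀ g h, |c.toFun g h| ≤ C) :
    ∃ b : G → ℝ, (∀ g, |b g| ≤ C) ∧ ∀ g h, c.toFun g h = b g + b h - b (g * h) := by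
  obtain ⟨ψ, hψ, hC⟩ := exists_homogeneousQuasimorphism
    (φ := fun x : c.Extension => x.fiber) (C := C) (fun x y => by
      have h : (x * y).fiber - x.fiber - y.fiber = c.toFun x.base y.base := by
        rw [Extension.fiber_mul]; ring
      rw [h]
      exact hc _ _)
  -- Derived subgroups of the extension project into those of `G`, so any lift of `t` serves
  -- upstairs.
  have hbase : ∀ x ∈ derivedSeries c.Extension n, ∀ y ∈ derivedSeries c.Extension n,
      ψ (x * y) = ψ x + ψ y := by
    have hproj : ∀ x ∈ derivedSeries c.Extension n, x.base ∈ derivedSeries G n := fun x hx =>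
      map_derivedSeries_le_derivedSeries Extension.proj n (Subgroup.mem_map_of_mem _ hx)
    intro x hx y hy
    refine hψ.map_mul_of_commuting_conjugates (derivedSeries c.Extension n) ?_ hx hy
    intro x hx y hy
    obtain ⟨t, ht⟩ := hL _ (hproj x hx) _ (hproj y hy)
    refine ⟨⟨t, 0⟩, fun u hu v hv => c.commute_of_commute_base hψ hC ?_⟩
    refine ht u.base ?_ v.base ?_
    · rcases hu with rfl | rfl <;> simp
    · rcases hv with rfl | rfl <;> simp
  have hall : ∀ x y, ψ (x * y) = ψ x + ψ y := by
    have hdesc : ∀ k ≤ n, ∀ x ∈ derivedSeries c.Extension k, ∀ y ∈ derivedSeries c.Extension k,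
        ψ (x * y) = ψ x + ψ y := by
      intro k hk
      induction hk using Nat.decreasingInduction with
      | self => exact hbase
      | of_succ k _ ih => exact fun x hx y hy => hψ.map_mul_of_commutator _ ih hx hy
    exact fun x y => hdesc 0 n.zero_le x (Subgroup.mem_top x) y (Subgroup.mem_top y)
  -- The bound holds because `ψ` stays within `C` of the fibre coordinate, here `0`. The cocycle
  -- appears as the central factor of `(g, 0) * (h, 0)` over `(g * h, 0)`.
  refine ⟨fun g => ψ ⟨g, 0⟩, fun g => by simpa using hC ⟨g, 0⟩, fun g h => ?_⟩
  have h1 := hall ⟨g, 0⟩ ⟨h, 0⟩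
  have h2 : (⟨g, 0⟩ * ⟨h, 0⟩ : c.Extension) = ⟨g * h, 0⟩ * Extension.central (c.toFun g h) := by
    rw [Extension.mul_central]
    ext <;> simp
  rw [h2, c.map_mul_central hψ hC] at h1
  linarith

theorem barDifferential_one_apply {G : Type*} [Group G] (b : (Fin 1 → G) → ℝ) (g : Fin 2 → G) :
    barDifferential G 1 b g = b ![g 1] - b ![g 0 * g 1] + b ![g 0] := by
  have h1 : (fun i : Fin 1 => g i.succ) = ![g 1] := by ext i; fin_cases i; rfl
  have h2 : (fun i : Fin 1 => g i.castSucc) = ![g 0] := by ext i; fin_cases i; rfl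
  have h3 : Fin.contractNth (Fin.castSucc (0 : Fin 1)) (· * ·) g = ![g 0 * g 1] := by
    ext i; fin_cases i; rfl
  simp only [barDifferential, LinearMap.coe_mk, AddHom.coe_mk, Fin.sum_univ_one, h1, h2, h3]
  norm_num
  ring

theorem barDifferential_two_apply {G : Type*} [Group G] (f : (Fin 2 → G) → ℝ) (g : Fin 3 → G) :
    barDifferential G 2 f g
      = f ![g 1, g 2] - f ![g 0 * g 1, g 2] + f ![g 0, g 1 * g 2] - f ![g 0, g 1] := by
  have h1 : (fun i : Fin 2 => g i.succ) = ![g 1, g 2] := by ext i; fin_cases i <;> rfl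
  have h2 : (fun i : Fin 2 => g i.castSucc) = ![g 0, g 1] := by ext i; fin_cases i <;> rfl
  have h3 : Fin.contractNth (Fin.castSucc (0 : Fin 2)) (· * ·) g = ![g 0 * g 1, g 2] := by
    ext i; fin_cases i <;> rfl
  have h4 : Fin.contractNth (Fin.castSucc (1 : Fin 2)) (· * ·) g = ![g 0, g 1 * g 2] := by
    ext i; fin_cases i <;> rfl
  simp only [barDifferential, LinearMap.coe_mk, AddHom.coe_mk, Fin.sum_univ_two, h1, h2, h3, h4]
  norm_num
  ring

/-- The second bounded cohomology of `G` vanishes if any two elements of some term of the derived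
series commute with their conjugates by a suitable element of `G`. -/
theorem subsingleton_boundedCohomology_two {G : Type*} [Group G] (n : ℕ)
    (hL : ∀ x ∈ derivedSeries G n, ∀ y ∈ derivedSeries G n, ∃ t : G,
      ∀ u ∈ ({x, y} : Set G), ∀ v ∈ ({x, y} : Set G), Commute u (t * v * t⁻¹)) :
    Subsingleton (BoundedCohomology G 2) := by
  rw [Submodule.Quotient.subsingleton_iff, Submodule.submoduleOf_eq_top]
  rintro f ⟨⟨C, hC⟩, hf⟩
  have hcocycle : ∀ g h k, f ![h, k] + f ![g, h * k] = f ![g * h, k] + f ![g, h] := by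
    intro g h k
    have h1 := congrFun (LinearMap.mem_ker.1 hf) ![g, h, k]
    rw [barDifferential_two_apply] at h1
    simp only [Matrix.cons_val, Pi.zero_apply] at h1
    linarith
  obtain ⟨b, hb, hfb⟩ := RealCocycle.exists_bounded_primitive n hL
    ⟨fun g h => f ![g, h], hcocycle⟩ fun g h => hC ![g, h]
  refine ⟨fun g => b (g 0), ⟨C, fun g => hb (g 0)⟩, ?_⟩
  funext g
  have hg : ![g 0, g 1] = g := by ext i; fin_cases i <;> rfl
  have h1 := hfb (g 0) (g 1)
  simp only [hg] at h1
  rw [barDifferential_one_apply, h1]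
  simp only [Matrix.cons_val]
  ring

/-! ### Groups of homeomorphisms of the line -/

/-- Both maps fix `d`, so monotonicity makes the two half-lines invariant, and on each of them one
of the maps is the identity. -/
theorem HomeoPlus.commute_of_fixed {p q : HomeoPlus ℝ} {d : ℝ} (hp : ∀ z, d ≤ z → p.1 z = z)
    (hq : ∀ z ≤ d, q.1 z = z) : Commute p q := by
  refine Subtype.ext (Homeomorph.ext fun z => ?_)
  change p.1 (q.1 z) = q.1 (p.1 z)
  rcases le_total z d with h | h
  · have h1 : p.1 z ≤ d := (p.2.monotone h).trans (hp d le_rfl).le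
    rw [hq z h, hq _ h1]
  · have h1 : d ≤ q.1 z := (hq d le_rfl).ge.trans (q.2.monotone h)
    rw [hp z h, hp _ h1]

theorem HomeoPlus.commute_conj {p q t : HomeoPlus ℝ} {c d : ℝ} (hp : ∀ z, d ≤ z → p.1 z = z)
    (hq : ∀ z ≤ c, q.1 z = z) (h : d ≤ t.1 c) : Commute p (t * q * t⁻¹) := by
  refine HomeoPlus.commute_of_fixed (d := t.1 c) (fun z hz => hp z (h.trans hz)) fun z hz => ?_
  change t.1 (q.1 (t.1.symm z)) = z
  rw [hq, t.1.apply_symm_apply]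
  rw [← t.2.le_iff_le]
  simpa using hz

/-- Vanishing criterion: some term of the derived series consists of elements fixing all points
outside a compact interval with endpoints in `J`, and `J` has no upper bound for the action. -/
theorem subsingleton_boundedCohomology_two_of_action {G : Type*} [Group G] (φ : G →* HomeoPlus ℝ)
    (hφ : Function.Injective φ) (J : Set ℝ) (hJ : ∀ c ∈ J, ∀ d ∈ J, ∃ t : G, d ≤ (φ t).1 c)
    (n : ℕ) (hbot : ∀ x ∈ derivedSeries G n, ∃ c ∈ J, ∀ z ≤ c, (φ x).1 z = z)
    (htop : ∀ x ∈ derivedSeries G n, ∃ d ∈ J, ∀ z, d ≤ z → (φ x).1 z = z) :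
    Subsingleton (BoundedCohomology G 2) := by
  refine subsingleton_boundedCohomology_two n fun x hx y hy => ?_
  obtain ⟨c₁, hc₁, hxc⟩ := hbot x hx
  obtain ⟨c₂, hc₂, hyc⟩ := hbot y hy
  obtain ⟨d₁, hd₁, hxd⟩ := htop x hx
  obtain ⟨d₂, hd₂, hyd⟩ := htop y hy
  -- One interval containing both supports lets a single `t` handle all four commutations.
  have hc : min c₁ c₂ ∈ J := by rcases min_choice c₁ c₂ with h | h <;> rwa [h]
  have hd : max d₁ d₂ ∈ J := by rcases max_choice d₁ d₂ with h | h <;> rwa [h]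
  obtain ⟨t, ht⟩ := hJ _ hc _ hd
  refine ⟨t, fun u hu v hv => Commute.of_map hφ ?_⟩
  rw [map_mul, map_mul, map_inv]
  refine HomeoPlus.commute_conj (fun z hz => ?_) (fun z hz => ?_) ht
  · rcases hu with rfl | rfl
    · exact hxd z ((le_max_left _ _).trans hz)
    · exact hyd z ((le_max_right _ _).trans hz)
  · rcases hv with rfl | rfl
    · exact hxc z (hz.trans (min_le_left _ _))
    · exact hyc z (hz.trans (min_le_right _ _))

/-! ### Minimal actions with solvable germs -/

theorem MonoidHom.exists_derivedSeries_le_ker {G Q : Type*} [Group G] [Group Q] (ψ : G →* Q)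
    (h : Group.IsSolvable ψ.range) : ∃ n, derivedSeries G n ≤ ψ.ker := by
  obtain ⟨n, hn⟩ := h.solvable
  refine ⟨n, fun x hx => ?_⟩
  have h1 := map_derivedSeries_le_derivedSeries ψ.rangeRestrict n (Subgroup.mem_map_of_mem _ hx)
  rw [hn, Subgroup.mem_bot] at h1
  exact congrArg Subtype.val h1

theorem AdmitsMinimalActionWithSolvableGerms.subsingleton_boundedCohomology_two {G : Type*}
    [Group G] (hG : AdmitsMinimalActionWithSolvableGerms G) :
    Subsingleton (BoundedCohomology G 2) := by
  obtain ⟨φ, hφ, hdense, htop, hbot⟩ := hG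
  rw [germsTop, ← MonoidHom.range_comp] at htop
  rw [germsBot, ← MonoidHom.range_comp] at hbot
  obtain ⟨m, hm⟩ := MonoidHom.exists_derivedSeries_le_ker _ htop
  obtain ⟨k, hk⟩ := MonoidHom.exists_derivedSeries_le_ker _ hbot
  -- The derived series decreases, so at stage `max m k` both germs are trivial; density of orbits
  -- supplies the displacing element.
  refine subsingleton_boundedCohomology_two_of_action φ hφ Set.univ (fun c _ d _ => ?_) (max m k)
    (fun x hx => ?_) (fun x hx => ?_)
  · obtain ⟨_, ⟨t, rfl⟩, h⟩ := (hdense c).exists_mem_open (isOpen_Ioi (a := d)) ⟨d + 1, lt_add_one d⟩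
    exact ⟨t, le_of_lt h⟩
  · have h := hk (derivedSeries_antitone G (le_max_right m k) hx)
    rw [MonoidHom.mem_ker, MonoidHom.comp_apply, QuotientGroup.mk'_apply,
      QuotientGroup.eq_one_iff] at h
    obtain ⟨c, hc⟩ := Filter.eventually_atBot.1 h
    exact ⟨c, trivial, hc⟩
  · have h := hm (derivedSeries_antitone G (le_max_left m k) hx)
    rw [MonoidHom.mem_ker, MonoidHom.comp_apply, QuotientGroup.mk'_apply,
      QuotientGroup.eq_one_iff] at h
    obtain ⟨d, hd⟩ := Filter.eventually_atTop.1 h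
    exact ⟨d, trivial, hd⟩

/-! ### Chain groups -/

/-- If the germs along `l` of the generators are powers of a single germ, then the elements of the
commutator subgroup have trivial germ along `l`. -/
theorem HomeoPlus.eventually_fixed_of_mem_commutator {l : Filter ℝ} {S : Set (HomeoPlus ℝ)}
    {u : HomeoPlus ℝ} (hS : ∀ s ∈ S, s = u ∨ ∀ᶠ z in l, s.1 z = z)
    (hl : ∀ s ∈ S, Filter.Tendsto s.1 l l ∧ Filter.Tendsto (s⁻¹).1 l l) {k : HomeoPlus ℝ}
    (hk : k ∈ ⁅Subgroup.closure S, Subgroup.closure S⁆) : ∀ᶠ z in l, k.1 z = z := by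
  have htendsto : ∀ g ∈ Subgroup.closure S,
      Filter.Tendsto g.1 l l ∧ Filter.Tendsto (g⁻¹).1 l l := by
    intro g hg
    induction hg using Subgroup.closure_induction with
    | mem s hs => exact hl s hs
    | one => exact ⟨Filter.tendsto_id, Filter.tendsto_id⟩
    | mul g h _ _ ihg ihh =>
      refine ⟨ihg.1.comp ihh.1, ?_⟩
      rw [mul_inv_rev]
      exact ihh.2.comp ihg.2
    | inv g _ ih => exact ⟨ih.2, by rw [inv_inv]; exact ih.1⟩
  have hgerm : ∀ g ∈ Subgroup.closure S, ∃ m : ℤ, ∀ᶠ z in l, g.1 z = (u ^ m).1 z := by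
    intro g hg
    induction hg using Subgroup.closure_induction with
    | mem s hs =>
      rcases hS s hs with rfl | h
      · exact ⟨1, by simp⟩
      · exact ⟨0, by simpa using h⟩
    | one => exact ⟨0, by simp⟩
    | mul g h hg hh ihg ihh =>
      obtain ⟨m, hm⟩ := ihg
      obtain ⟨k, hk⟩ := ihh
      refine ⟨m + k, ?_⟩
      filter_upwards [(htendsto h hh).1.eventually hm, hk] with z h1 h2
      rw [zpow_add]
      change g.1 (h.1 z) = (u ^ m).1 ((u ^ k).1 z)
      rw [h1, h2]
    | inv g hg ih =>
      obtain ⟨m, hm⟩ := ih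
      refine ⟨-m, ?_⟩
      filter_upwards [(htendsto g hg).2.eventually hm] with z h1
      have h2 : g.1 ((g⁻¹).1 z) = z := g.1.apply_symm_apply z
      rw [zpow_neg]
      change _ = (u ^ m).1.symm z
      rw [Homeomorph.eq_symm_apply, ← h1, h2]
  rw [Subgroup.commutator_def] at hk
  induction hk using Subgroup.closure_induction with
  | mem k hk =>
    obtain ⟨g, hg, h, hh, rfl⟩ := hk
    obtain ⟨m, hm⟩ := hgerm g hg
    obtain ⟨k, hk⟩ := hgerm h hh
    -- The germs of `g * h` and `h * g` agree, both being `u ^ (m + k)`. They are compared at `(h *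
    -- g)⁻¹ z`, which follows `l` when `z` does.
    have h1 := (htendsto _ (mul_mem hh hg)).2.eventually
      (((htendsto g hg).1.eventually hk).and (((htendsto h hh).1.eventually hm).and (hm.and hk)))
    filter_upwards [h1] with z ⟨h2, h3, h4, h5⟩
    have h6 : ⁅g, h⁆ = g * h * (h * g)⁻¹ := by simp [commutatorElement_def, mul_assoc]
    have h7 : h.1 (g.1 (((h * g)⁻¹).1 z)) = z := (h * g).1.apply_symm_apply z
    rw [h6]
    change g.1 (h.1 (((h * g)⁻¹).1 z)) = z
    refine Eq.trans ?_ h7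
    rw [h2, h3, h4, h5]
    change (u ^ m * u ^ k).1 _ = (u ^ k * u ^ m).1 _
    rw [← zpow_add, ← zpow_add, add_comm]
  | one => exact Filter.Eventually.of_forall fun _ => rfl
  | mul g h _ _ ihg ihh =>
    filter_upwards [ihg, ihh] with z h1 h2
    change g.1 (h.1 z) = z
    rw [h2, h1]
  | inv g _ ih =>
    filter_upwards [ih] with z h
    change g.1.symm z = z
    rw [g.1.symm_apply_eq, h]

/-- A version of `HomeoPlus.eventually_fixed_of_mem_commutator` for the ends of an invariant set
`J`; `B` is meant to be `Set.Iic` or `Set.Ici`. -/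
theorem HomeoPlus.exists_fixed_of_mem_commutator {B : ℝ → Set ℝ}
    (hB : ∀ (f : HomeoPlus ℝ) (c z : ℝ), f.1 z ∈ B (f.1 c) ↔ z ∈ B c)
    (hdir : ∀ c d, B c ⊆ B d ∨ B d ⊆ B c) {J : Set ℝ} (hne : J.Nonempty) {S : Set (HomeoPlus ℝ)}
    (hJ : ∀ s ∈ S, ∀ x, s.1 x ∈ J ↔ x ∈ J) {u : HomeoPlus ℝ}
    (hS : ∀ s ∈ S, s = u ∨ ∃ c ∈ J, ∀ z ∈ B c, s.1 z = z) {k : HomeoPlus ℝ}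
    (hk : k ∈ ⁅Subgroup.closure S, Subgroup.closure S⁆) : ∃ c ∈ J, ∀ z ∈ B c, k.1 z = z := by
  -- This filter describes one end of `J`. The generators permute both `J` and the sets `B c`, hence
  -- preserve it.
  have hbasis : (⨅ c ∈ J, Filter.principal (B c)).HasBasis (· ∈ J) B := by
    refine Filter.hasBasis_biInf_principal (fun c hc d hd => ?_) hne
    rcases hdir c d with h | h
    · exact ⟨c, hc, subset_rfl, h⟩
    · exact ⟨d, hd, h, subset_rfl⟩
  have hinv : ∀ (s : HomeoPlus ℝ) x, s.1 ((s⁻¹).1 x) = x := fun s x => s.1.apply_symm_apply x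
  refine hbasis.eventually_iff.1 (HomeoPlus.eventually_fixed_of_mem_commutator
    (u := u) (fun s hs => (hS s hs).imp_right hbasis.eventually_iff.2) (fun s hs => ⟨?_, ?_⟩) hk)
  · refine (hbasis.tendsto_iff hbasis).2 fun c hc => ⟨(s⁻¹).1 c, ?_, fun z hz => ?_⟩
    · rwa [← hJ s hs, hinv]
    · rwa [← hB s, hinv] at hz
  · refine (hbasis.tendsto_iff hbasis).2 fun c hc => ⟨s.1 c, (hJ s hs c).2 hc, fun z hz => ?_⟩
    rwa [← hB s, hinv]

/-- A group of homeomorphisms without fixed points in the order connected set `J` moves every point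
of `J` past any other. -/
theorem HomeoPlus.exists_le_apply {Γ : Subgroup (HomeoPlus ℝ)} {J : Set ℝ} (hJ : J.OrdConnected)
    (hfix : ∀ x ∈ J, ∃ g ∈ Γ, g.1 x ≠ x) {c d : ℝ} (hc : c ∈ J) (hd : d ∈ J) :
    ∃ t ∈ Γ, d ≤ t.1 c := by
  by_contra! hlt
  have hbdd : BddAbove (Set.range fun t : Γ => t.1.1 c) :=
    ⟨d, by rintro _ ⟨t, rfl⟩; exact (hlt t t.2).le⟩
  -- The supremum of a bounded orbit is fixed by `Γ`: invariance of the orbit gives `s ≤ g s` for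
  -- `g` and for `g⁻¹`. As `c ≤ s ≤ d`, it lies in `J`, a contradiction.
  set s := ⨆ t : Γ, t.1.1 c
  have hle : ∀ t ∈ Γ, t.1 c ≤ s := fun t ht => le_ciSup hbdd ⟨t, ht⟩
  have hsJ : s ∈ J := hJ.out hc hd ⟨hle 1 (one_mem Γ), ciSup_le fun t => (hlt t t.2).le⟩
  have hge : ∀ g ∈ Γ, s ≤ g.1 s := by
    intro g hg
    refine ciSup_le fun t => ?_
    have h1 := g.2.monotone (hle (g⁻¹ * t.1) (mul_mem (inv_mem hg) t.2))
    have h2 : g.1 ((g⁻¹ * t.1).1 c) = t.1.1 c := g.1.apply_symm_apply _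
    rwa [h2] at h1
  obtain ⟨g, hg, hne⟩ := hfix s hsJ
  refine hne (le_antisymm ?_ (hge g hg))
  have h1 := g.2.monotone (hge g⁻¹ (inv_mem hg))
  have h2 : g.1 ((g⁻¹).1 s) = s := g.1.apply_symm_apply s
  rwa [h2] at h1

/-! ### Order structure of chains of intervals -/

theorem openInterval_ordConnected (a b : EReal) : (openInterval a b).OrdConnected :=
  ⟨fun _ hx _ hy _ hz => ⟨hx.1.trans_le (EReal.coe_le_coe_iff.2 hz.1),
    (EReal.coe_le_coe_iff.2 hz.2).trans_lt hy.2⟩⟩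

namespace IsChainOfIntervals

variable {m : ℕ} {a b : Fin (m + 2) → EReal}

theorem strictMono_left (h : IsChainOfIntervals a b) : StrictMono a :=
  Fin.strictMono_iff_lt_succ.2 fun i => h.left_lt _ _ (by simp)

/-- Left endpoints increase, so a right endpoint that failed to increase would put an interval
inside its predecessor, against properness of the intersection. -/
theorem strictMono_right (h : IsChainOfIntervals a b) : StrictMono b := by
  refine Fin.strictMono_iff_lt_succ.2 fun i => ?_
  by_contra! hle
  refine (h.inter_ssubset_right i.castSucc i.succ (by simp)).2 fun x hx => ⟨⟨?_, ?_⟩, hx⟩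
  · exact (h.left_lt i.castSucc i.succ (by simp)).trans hx.1
  · exact hx.2.trans_le hle

theorem ordConnected_iUnion (h : IsChainOfIntervals a b) :
    (⋃ i, openInterval (a i) (b i)).OrdConnected := by
  refine (IsPreconnected.iUnion_of_chain
    (fun i => (openInterval_ordConnected _ _).isPreconnected) fun i => ?_).ordConnected
  induction i using Fin.lastCases with
  | last =>
    -- The last index is its own successor, so the overlap required is the interval itself.
    rw [Order.succ_eq_iff_isMax.2 (fun j _ => Fin.le_last j), Set.inter_self]
    exact h.nonempty _
  | cast i =>
    rw [Fin.orderSucc_castSucc]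
    exact h.inter_nonempty _ _ (by simp)

/-- A point of the first interval outside the second lies to the left of the second, hence of all
later ones: there only the first generator acts. -/
theorem exists_left_end (h : IsChainOfIntervals a b) :
    ∃ c ∈ openInterval (a 0) (b 0), ∀ i, i ≠ 0 → ∀ z ≤ c, z ∉ openInterval (a i) (b i) := by
  obtain ⟨c, hc, hc'⟩ := Set.exists_of_ssubset (h.inter_ssubset_left 0 1 (by simp))
  refine ⟨c, hc, fun i hi z hz hzi => hc' ⟨hc, ?_, hc.2.trans (h.strictMono_right Fin.zero_lt_one)⟩⟩
  exact ((h.strictMono_left.monotone (Fin.one_le_of_ne_zero hi)).trans_lt hzi.1).trans_le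
    (EReal.coe_le_coe_iff.2 hz)

theorem exists_right_end (h : IsChainOfIntervals a b) :
    ∃ d ∈ openInterval (a (Fin.last _)) (b (Fin.last _)),
      ∀ i, i ≠ Fin.last _ → ∀ z, d ≤ z → z ∉ openInterval (a i) (b i) := by
  obtain ⟨d, hd, hd'⟩ := Set.exists_of_ssubset
    (h.inter_ssubset_right (Fin.last m).castSucc (Fin.last _) (by simp))
  refine ⟨d, hd, fun i hi z hz hzi =>
    hd' ⟨⟨(h.strictMono_left (Fin.castSucc_lt_last _)).trans hd.1, ?_⟩, hd⟩⟩
  have hi' : i ≤ (Fin.last m).castSucc := by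
    have := Fin.val_lt_last hi
    exact Fin.le_def.2 (by simpa using Nat.le_of_lt_succ this)
  exact ((EReal.coe_le_coe_iff.2 hz).trans_lt hzi.2).trans_le (h.strictMono_right.monotone hi')

end IsChainOfIntervals

theorem IsChainGroup.subsingleton_boundedCohomology_two {G : Type*} [Group G]
    (hG : IsChainGroup G) : Subsingleton (BoundedCohomology G 2) := by
  obtain ⟨n, a, b, f, hn, hchain, hsupp, -, -, ⟨e⟩⟩ := hG
  obtain ⟨m, rfl⟩ := Nat.exists_eq_add_of_le' hn
  have hfix : ∀ i x, x ∉ openInterval (a i) (b i) → (f i).1 x = x := by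
    intro i x hx
    rw [← hsupp i] at hx
    exact not_not.1 hx
  set J := ⋃ i, openInterval (a i) (b i)
  -- A homeomorphism permutes its own support and fixes everything else.
  have hJ_inv : ∀ s ∈ Set.range f, ∀ x, s.1 x ∈ J ↔ x ∈ J := by
    rintro _ ⟨i, rfl⟩ x
    by_cases hx : (f i).1 x = x
    · rw [hx]
    · have h1 : x ∈ openInterval (a i) (b i) := by rw [← hsupp i]; exact hx
      have h2 : (f i).1 x ∈ openInterval (a i) (b i) := by
        rw [← hsupp i]
        exact fun h => hx ((f i).1.injective h)
      exact iff_of_true (Set.mem_iUnion_of_mem i h2) (Set.mem_iUnion_of_mem i h1)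
  obtain ⟨c, hc, hc'⟩ := hchain.exists_left_end
  obtain ⟨d, hd, hd'⟩ := hchain.exists_right_end
  have hcJ : c ∈ J := Set.mem_iUnion_of_mem _ hc
  have hdJ : d ∈ J := Set.mem_iUnion_of_mem _ hd
  have hmove : ∀ x ∈ J, ∃ g ∈ Subgroup.closure (Set.range f), g.1 x ≠ x := by
    intro x hx
    obtain ⟨i, hi⟩ := Set.mem_iUnion.1 hx
    rw [← hsupp i] at hi
    exact ⟨f i, Subgroup.subset_closure ⟨i, rfl⟩, hi⟩
  have hcomm : ∀ x ∈ derivedSeries G 1, (e x : HomeoPlus ℝ) ∈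
      ⁅Subgroup.closure (Set.range f), Subgroup.closure (Set.range f)⁆ := by
    intro x hx
    have h1 := Subgroup.mem_map_of_mem ((Subgroup.subtype _).comp e.toMonoidHom) hx
    rw [derivedSeries_succ, Subgroup.map_commutator] at h1
    refine Subgroup.commutator_mono ?_ ?_ h1 <;>
    · rintro _ ⟨y, -, rfl⟩
      exact (e y).2
  -- The first derived subgroup suffices: at the left end of `J` every germ is a power of that of `f
  -- 0`, at the right end of that of the last generator.
  refine subsingleton_boundedCohomology_two_of_action ((Subgroup.subtype _).comp e.toMonoidHom)
    (Subtype.val_injective.comp e.injective) J (fun c hc d hd => ?_) 1 (fun x hx => ?_)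
    (fun x hx => ?_)
  · obtain ⟨t, ht, h⟩ := HomeoPlus.exists_le_apply hchain.ordConnected_iUnion hmove hc hd
    exact ⟨e.symm ⟨t, ht⟩, by simpa using h⟩
  · refine HomeoPlus.exists_fixed_of_mem_commutator (B := Set.Iic) (u := f 0)
      (fun g _ _ => g.2.le_iff_le)
      (fun c d => (le_total c d).imp Set.Iic_subset_Iic.2 Set.Iic_subset_Iic.2) ⟨c, hcJ⟩ hJ_inv ?_
      (hcomm x hx)
    rintro _ ⟨i, rfl⟩
    exact or_iff_not_imp_left.2 fun hi =>
      ⟨c, hcJ, fun z hz => hfix i z (hc' i (fun h => hi (by rw [h])) z hz)⟩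
  · refine HomeoPlus.exists_fixed_of_mem_commutator (B := Set.Ici) (u := f (Fin.last _))
      (fun g _ _ => g.2.le_iff_le)
      (fun c d => (le_total d c).imp Set.Ici_subset_Ici.2 Set.Ici_subset_Ici.2) ⟨c, hcJ⟩ hJ_inv ?_
      (hcomm x hx)
    rintro _ ⟨i, rfl⟩
    exact or_iff_not_imp_left.2 fun hi =>
      ⟨d, hdJ, fun z hz => hfix i z (hd' i (fun h => hi (by rw [h])) z hz)⟩

theorem corollary1p5 (G : Type*) [Group G]
    (hG : IsChainGroup G ∨ AdmitsMinimalActionWithSolvableGerms G) :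
    Subsingleton (BoundedCohomology G 2) :=
  hG.elim IsChainGroup.subsingleton_boundedCohomology_two
    AdmitsMinimalActionWithSolvableGerms.subsingleton_boundedCohomology_two
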